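/- Let $n\ge 2$, and let $Y_1,\dots,Y_n$ be identically distributed real random variables on a probability space $(\Omega,\mathcal F,\mathbb P)$ such that - (super-Pareto) each $Y_i$ has the same distribution as $f(V)$ for some increasing (in the non-strict sense), convex and non-constant $f:[1,\infty)\to\mathbb R$, where $\mathbb P(V\le x)=1-1/x$ for $x\ge 1$; - (weak negative association) $\mathbb P(\mathbf Y_{-i}\in S\mid Y_i\le x)\le \mathbb P(\mathbf Y_{-i}\in S)$ for every $i$, every Borel set $S\subseteq\mathbb R^{n-1}$ that is decreasing ($\mathbf x\in S$ and $\mathbf y\le\mathbf x$ imply $\mathbf y\in S$) and every $x\in\mathbb R$ with $\mathbb P(Y_i\le x)>0$, where $\mathbf Y_{-i}=(Y_j)_{j\ne i}$. For $\mathbf w\in\mathbb R^n$ let $\|\mathbf w\|=\sum_i|w_i|$ and $\mathbf w\cdot\mathbf Y=\sum_i w_iY_i$. Let $g:\mathbb R\to\mathbb R$ be any function. Let $\rho:\mathcal X_\rho\to[-\infty,\infty]$, where $\mathcal X_\rho$ is a set of random variables on $\Omega$ containing every random variable that has the same distribution as $\mathbf w\cdot\mathbf Y-g(\|\mathbf w\|)$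 for some $\mathbf w\in\mathbb R_+^n$. Write $X\le_{\rm st}Z$ if $\mathbb P(X\le x)\ge\mathbb P(Z\le x)$ for all $x\in\mathbb R$. Assume that $\rho$ is weakly monotone: $\rho(X)\le\rho(Z)$ for all $X,Z\in\mathcal X_\rho$ with $X\le_{\rm st}Z$. We say that $\rho$ is mildly monotone if, in addition, $\rho(X)<\rho(Z)$ for all $X,Z\in\mathcal X_\rho$ with $\mathbb P(X<Z)=1$. Consider the problems (1) minimize $\rho(\mathbf w\cdot\mathbf Y-g(\|\mathbf w\|))$ subject to $\mathbf w\in\mathbb R_+^n$ and $\|\mathbf w\|=w$, for a given $w>0$; (2) minimize $\rho(\mathbf w\cdot\mathbf Y-g(\|\mathbf w\|))$ subject to $\mathbf w\in\mathbb R_+^n$. For $w\ge 0$ let $E_w=\{w\mathbf e_1,\dots,w\mathbf e_n\}$, where $\mathbf e_i$ is the $i$-th standard basis vector. Then: (i) Suppose that $\rho$ is mildly monotone and that no two of the losses take a common value with positive probability, that is, $\mathbb P(Y_i=Y_j=x)=0$ for all $i\neq j$ and $x\in\mathbb R$ (this is automatic if the distribution of $Y_1$ is continuous). Then, for every $w>0$,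 the set of minimizers of (1) is exactly $E_w$, and the set of minimizers of (2) is contained in $\bigcup_{w\ge0}E_w$. (ii) Without these two additional assumptions: for every $w>0$, if (1) has a minimizer, then it has a minimizer in $E_w$; if (2) has a minimizer, then it has a minimizer in $\bigcup_{w\ge 0}E_w$. -/

import Mathlib

open MeasureTheory ProbabilityTheory

/-- A random variable `X` is super-Pareto if it is distributed as `f(V)`, where `V ∼ Pareto(1)`,
i.e. `ℙ(V ≤ x) = 1 - 1/x` for `x ≥ 1`, and `f : [1, ∞) → ℝ` is increasing (in the non-strict
sense), convex and non-constant. -/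
def IsSuperPareto {Ω : Type*} [MeasurableSpace Ω] (P : Measure Ω) (X : Ω → ℝ) : Prop :=
  ∃ f : ℝ → ℝ, MonotoneOn f (Set.Ici 1) ∧ ConvexOn ℝ (Set.Ici 1) f ∧
    (∃ x ∈ Set.Ici (1 : ℝ), ∃ y ∈ Set.Ici (1 : ℝ), f x ≠ f y) ∧
    IdentDistrib X f P (paretoMeasure 1 1)

/-- Weak negative association: for every `i`, every (Borel) decreasing set `S` of values of the
other coordinates and every `x` with `ℙ(X_i ≤ x) > 0`,
`ℙ(X_{-i} ∈ S ∣ X_i ≤ x) ≤ ℙ(X_{-i} ∈ S)`. -/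
def WeaklyNegativelyAssociated {Ω : Type*} [MeasurableSpace Ω] (P : Measure Ω) {n : ℕ}
    (X : Fin n → Ω → ℝ) : Prop :=
  ∀ (i : Fin n) (S : Set ({j : Fin n // j ≠ i} → ℝ)), IsLowerSet S → MeasurableSet S →
    ∀ x : ℝ, 0 < P {ω | X i ω ≤ x} →
      ProbabilityTheory.cond P {ω | X i ω ≤ x} {ω | (fun j : {j : Fin n // j ≠ i} => X j ω) ∈ S}
        ≤ P {ω | (fun j : {j : Fin n // j ≠ i} => X j ω) ∈ S}

/-- `X_1, …, X_n` are WNAID super-Pareto random variables: weakly negatively associated,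
identically distributed and super-Pareto. -/
structure IsWNAIDSuperPareto {Ω : Type*} [MeasurableSpace Ω] (P : Measure Ω) {n : ℕ}
    (X : Fin n → Ω → ℝ) : Prop where
  measurable : ∀ i, Measurable (X i)
  wna : WeaklyNegativelyAssociated P X
  identDistrib : ∀ i j, IdentDistrib (X i) (X j) P P
  superPareto : ∀ i, IsSuperPareto P (X i)

/-- First-order stochastic dominance `X ≤_st Y`. -/
def StochLE {Ω : Type*} [MeasurableSpace Ω] (P : Measure Ω) (X Y : Ω → ℝ) : Prop :=
  ∀ x : ℝ, P {ω | Y ω ≤ x} ≤ P {ω | X ω ≤ x}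

/-- Weak monotonicity of a risk measure `ρ` with domain `D`. A risk measure is a functional
`D → [-∞, ∞]`; it is represented by a total function whose values outside `D` play no role. -/
def WeaklyMonotone {Ω : Type*} [MeasurableSpace Ω] (P : Measure Ω) (D : Set (Ω → ℝ))
    (ρ : (Ω → ℝ) → EReal) : Prop :=
  ∀ X ∈ D, ∀ Y ∈ D, StochLE P X Y → ρ X ≤ ρ Y

/-- Mild monotonicity: weak monotonicity, and `ρ X < ρ Y` whenever `X < Y` almost surely. -/
def MildlyMonotone {Ω : Type*} [MeasurableSpace Ω] (P : Measure Ω) (D : Set (Ω → ℝ))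
    (ρ : (Ω → ℝ) → EReal) : Prop :=
  WeaklyMonotone P D ρ ∧ ∀ X ∈ D, ∀ Y ∈ D, (∀ᵐ ω ∂P, X ω < Y ω) → ρ X < ρ Y

/-- The total exposure `‖w‖ = ∑ |w_i|`. -/
def totalExposure {n : ℕ} (w : Fin n → ℝ) : ℝ := ∑ i, |w i|

/-- The total loss `w · Y - g(‖w‖)` of the position `w`. -/
def portfolioLoss {Ω : Type*} {n : ℕ} (Y : Fin n → Ω → ℝ) (g : ℝ → ℝ) (w : Fin n → ℝ) :
    Ω → ℝ :=
  fun ω => ∑ i, w i * Y i ω - g (totalExposure w)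

/-- The positions `ℝ₊ⁿ`. -/
def positions (n : ℕ) : Set (Fin n → ℝ) := {w | ∀ i, 0 ≤ w i}

/-- The positions in `ℝ₊ⁿ` with total exposure `c`. -/
def positionsOfExposure (n : ℕ) (c : ℝ) : Set (Fin n → ℝ) :=
  {w | w ∈ positions n ∧ totalExposure w = c}

/-- The set of minimizers of `w ↦ ρ(w · Y - g(‖w‖))` over the feasible set `F`. -/
def minimizers {Ω : Type*} {n : ℕ} (ρ : (Ω → ℝ) → EReal) (Y : Fin n → Ω → ℝ) (g : ℝ → ℝ)
    (F : Set (Fin n → ℝ)) : Set (Fin n → ℝ) :=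
  {w | w ∈ F ∧ ∀ v ∈ F, ρ (portfolioLoss Y g w) ≤ ρ (portfolioLoss Y g v)}

/-- `E_c = {c e_i : i ∈ [n]}`, the positions taking only one loss, with exposure `c`. -/
def concentratedPositions (n : ℕ) (c : ℝ) : Set (Fin n → ℝ) :=
  Set.range fun i : Fin n => Pi.single i c

/-! ### The Pareto distribution with both parameters equal to one -/

/-! Spreading exposure `c` over several losses makes the total stochastically larger. Since `Y i ≥ f
1` a.s., `∑ w i * Y i ≤ c * f v` forces `Y i ≤ f 1 + (c / w i) * (f v - f 1)` whenever `w i > 0`.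
When `f 1 < f v`, convexity bounds the probability of this event by the Pareto value `(1 + w i / (c
* (v - 1)))⁻¹`, and weak negative association lets these bounds multiply. As `∏ (1 + x i) ≥ 1 + ∑ x
i`, the product is at most `(1 + 1 / (v - 1))⁻¹ = 1 - 1 / v`, the probability that the Pareto
variable is at most `v` (`measureReal_weighted_sum_le_one_sub`). This is the dominance behind the
weakly monotone part.

With two positive weights the product inequality is strict, but mild monotonicity needs an almost
sure strict order. `exists_identDistrib_lt` supplies it by a quantile coupling: one uniform `U` on
`Ω` drives versions of both the single loss and the sum. Such a `U` exists because a super-Pareto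
law has at most one atom, at `f 1`, and two losses do not share it. -/

lemma paretoMeasure_one_one_Ioi {v : ℝ} (hv : 1 ≤ v) :
    paretoMeasure 1 1 (Set.Ioi v) = ENNReal.ofReal (1 / v) := by
  have hv0 : 0 < v := by linarith
  have hint : IntegrableOn (fun x : ℝ => x ^ (-2 : ℝ)) (Set.Ioi v) :=
    integrableOn_Ioi_rpow_of_lt (by norm_num) hv0
  rw [paretoMeasure, withDensity_apply _ measurableSet_Ioi,
    setLIntegral_congr_fun (g := fun x : ℝ => ENNReal.ofReal (x ^ (-2 : ℝ))) measurableSet_Ioi,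
    ← ofReal_integral_eq_lintegral_ofReal hint, integral_Ioi_rpow_of_lt (by norm_num) hv0]
  · congr 1
    norm_num [Real.rpow_neg_one]
  · filter_upwards [ae_restrict_mem measurableSet_Ioi] with x hx
    exact Real.rpow_nonneg (hv0.le.trans (le_of_lt hx)) _
  · intro x hx
    have hx' : (1 : ℝ) ≤ x := hv.trans (le_of_lt hx)
    simp only [paretoPDF_of_le hx']
    norm_num

lemma paretoMeasure_one_one_Iio : paretoMeasure 1 1 (Set.Iio 1) = 0 := by
  rw [paretoMeasure, withDensity_apply _ measurableSet_Iio]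
  exact lintegral_paretoPDF_of_le le_rfl

instance : IsProbabilityMeasure (paretoMeasure 1 1) :=
  isProbabilityMeasure_paretoMeasure one_pos one_pos

lemma paretoMeasure_one_one_real_Iic {v : ℝ} (hv : 1 ≤ v) :
    (paretoMeasure 1 1).real (Set.Iic v) = 1 - 1 / v := by
  rw [← Set.compl_Ioi, probReal_compl_eq_one_sub measurableSet_Ioi, measureReal_def,
    paretoMeasure_one_one_Ioi hv, ENNReal.toReal_ofReal (by positivity)]

lemma paretoMeasure_one_one_singleton (v : ℝ) : paretoMeasure 1 1 {v} = 0 :=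
  withDensity_absolutelyContinuous _ _ (by simp)

lemma paretoMeasure_one_one_ae_ge : ∀ᵐ v ∂paretoMeasure 1 1, 1 ≤ v := by
  rw [ae_iff]
  simpa only [not_le] using! paretoMeasure_one_one_Iio

/-! ### Increasing convex functions on `[1, ∞)` -/

/-- Secant slopes from the point `1` increase, so stretching `v - 1` by more than `k` stretches `f v
- f 1` by more than `k`. -/
lemma ConvexOn.lt_of_one_add_mul_lt {f : ℝ → ℝ} (hf : ConvexOn ℝ (Set.Ici 1) f) {v k s : ℝ}
    (hv : 1 < v) (hfv : f 1 < f v) (hk : 1 ≤ k) (hs : 1 + (v - 1) * k < s) :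
    f 1 + k * (f v - f 1) < f s := by
  have hv1 : 0 < v - 1 := by linarith
  have hvs : v ≤ s := by nlinarith
  have hs1 : 0 < s - 1 := by linarith
  have h := hf.secant_mono (a := 1) (x := v) (y := s) Set.self_mem_Ici hv.le
    (hv.le.trans hvs) hv.ne' (by linarith) hvs
  rw [div_le_div_iff₀ hv1 hs1] at h
  have h2 : (v - 1) * k * (f v - f 1) < (s - 1) * (f v - f 1) :=
    mul_lt_mul_of_pos_right (by linarith) (by linarith)
  nlinarith

lemma ConvexOn.lt_of_lt_of_one_lt {f : ℝ → ℝ} (hf : ConvexOn ℝ (Set.Ici 1) f) {a b : ℝ}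
    (ha : 1 ≤ a) (hab : a < b) (hfa : f 1 < f a) : f a < f b := by
  have ha' : 1 < a := lt_of_le_of_ne ha (by rintro rfl; exact lt_irrefl _ hfa)
  simpa using hf.lt_of_one_add_mul_lt ha' hfa le_rfl (by simpa using hab)

/-- Once `f` exceeds `f 1` it is strictly increasing, so any other level is attained at most once on
`[1, ∞)`. Hence `f 1` is the only possible atom. -/
lemma paretoMeasure_one_one_level {f : ℝ → ℝ} (hf : ConvexOn ℝ (Set.Ici 1) f)
    (hmono : MonotoneOn f (Set.Ici 1)) {x : ℝ} (hx : x ≠ f 1) :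
    paretoMeasure 1 1 (f ⁻¹' {x}) = 0 := by
  have hsub : (Set.Ici (1 : ℝ) ∩ f ⁻¹' {x}).Subsingleton := by
    rintro a ⟨ha, rfl⟩ b ⟨hb, hba⟩
    have h1 : f 1 < f a := lt_of_le_of_ne (hmono Set.self_mem_Ici ha ha) hx.symm
    rcases lt_trichotomy a b with h | h | h
    · exact absurd hba (hf.lt_of_lt_of_one_lt ha h h1).ne'
    · exact h
    · have hba' : f b = f a := hba
      exact absurd hba' (hf.lt_of_lt_of_one_lt hb h (hba' ▸ h1)).ne
  refine measure_mono_null (t := Set.Iio 1 ∪ (Set.Ici (1 : ℝ) ∩ f ⁻¹' {x})) ?_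
    (measure_union_null paretoMeasure_one_one_Iio ?_)
  · intro v hv
    rcases lt_or_ge v 1 with h | h
    · exact Or.inl h
    · exact Or.inr ⟨h, hv⟩
  · rcases hsub.eq_empty_or_singleton with h | ⟨v, h⟩
    · simp [h]
    · rw [h, paretoMeasure_one_one_singleton]

/-! ### Products and sums of positive numbers -/

lemma Finset.one_add_sum_le_prod_one_add' {ι : Type*} (s : Finset ι) (x : ι → ℝ)
    (hx : ∀ i ∈ s, 0 ≤ x i) : 1 + ∑ i ∈ s, x i ≤ ∏ i ∈ s, (1 + x i) := by
  classical
  induction s using Finset.induction_on with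
  | empty => simp
  | insert i s hi ih =>
    have ih' := ih fun j hj => hx j (Finset.mem_insert_of_mem hj)
    have h0 := hx i (Finset.mem_insert_self i s)
    have hs : 0 ≤ ∑ j ∈ s, x j :=
      Finset.sum_nonneg fun j hj => hx j (Finset.mem_insert_of_mem hj)
    rw [Finset.sum_insert hi, Finset.prod_insert hi]
    nlinarith

lemma Finset.one_add_sum_lt_prod_one_add {ι : Type*} (s : Finset ι) (x : ι → ℝ)
    (hx : ∀ i ∈ s, 0 < x i) (hs : s.Nontrivial) : 1 + ∑ i ∈ s, x i < ∏ i ∈ s, (1 + x i) := by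
  classical
  obtain ⟨i, hi, j, hj, hij⟩ := hs
  have h := Finset.one_add_sum_le_prod_one_add' (s.erase i) x
    fun k hk => (hx k (Finset.mem_of_mem_erase hk)).le
  have hpos : 0 < ∑ k ∈ s.erase i, x k :=
    Finset.sum_pos (fun k hk => hx k (Finset.mem_of_mem_erase hk))
      ⟨j, Finset.mem_erase.2 ⟨hij.symm, hj⟩⟩
  rw [← Finset.add_sum_erase s x hi, ← Finset.mul_prod_erase s _ hi]
  nlinarith [hx i hi]

/-! ### Stochastic dominance of weighted sums over single losses -/

section Dominance

variable {Ω : Type*} [MeasurableSpace Ω] {P : Measure Ω} {n : ℕ} {Y : Fin n → Ω → ℝ} {f : ℝ → ℝ}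

lemma ae_le_of_identDistrib_pareto (hmono : MonotoneOn f (Set.Ici 1)) {X : Ω → ℝ}
    (hX : IdentDistrib X f P (paretoMeasure 1 1)) : ∀ᵐ ω ∂P, f 1 ≤ X ω := by
  refine hX.symm.ae_snd (p := fun x => f 1 ≤ x) measurableSet_Ici ?_
  filter_upwards [paretoMeasure_one_one_ae_ge] with v hv using hmono Set.self_mem_Ici hv hv

lemma measureReal_le_of_identDistrib_pareto (hconv : ConvexOn ℝ (Set.Ici 1) f) {X : Ω → ℝ}
    (hX : IdentDistrib X f P (paretoMeasure 1 1)) {v k : ℝ} (hv : 1 < v) (hfv : f 1 < f v)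
    (hk : 1 ≤ k) :
    P.real {ω | X ω ≤ f 1 + k * (f v - f 1)} ≤ 1 - 1 / (1 + (v - 1) * k) := by
  have h1 : 1 ≤ 1 + (v - 1) * k := by nlinarith
  rw [← paretoMeasure_one_one_real_Iic h1]
  have h := hX.measure_mem_eq (measurableSet_Iic (a := f 1 + k * (f v - f 1)))
  have h' : P.real {ω | X ω ≤ f 1 + k * (f v - f 1)} =
      (paretoMeasure 1 1).real (f ⁻¹' Set.Iic (f 1 + k * (f v - f 1))) :=
    congrArg ENNReal.toReal h
  rw [h']
  refine ENNReal.toReal_mono (measure_ne_top _ _) (measure_mono ?_)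
  intro s hs
  by_contra hs'
  exact absurd hs (not_le.2 (hconv.lt_of_one_add_mul_lt hv hfv hk (not_le.1 hs')))

variable [IsProbabilityMeasure P]

/-- Weakly negatively associated random variables are negatively lower orthant dependent. -/
lemma WeaklyNegativelyAssociated.measureReal_forall_le_le_prod
    (hY : WeaklyNegativelyAssociated P Y) (hm : ∀ i, Measurable (Y i)) (a : Fin n → ℝ)
    (s : Finset (Fin n)) :
    P.real {ω | ∀ i ∈ s, Y i ω ≤ a i} ≤ ∏ i ∈ s, P.real {ω | Y i ω ≤ a i} := by
  induction s using Finset.induction_on with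
  | empty => simp
  | insert i s hi ih =>
    rw [Finset.prod_insert hi]
    have hset : {ω | ∀ j ∈ insert i s, Y j ω ≤ a j} =
        {ω | Y i ω ≤ a i} ∩ {ω | ∀ j ∈ s, Y j ω ≤ a j} := by
      ext ω; simp
    rw [hset]
    -- Conditioning requires positive probability; otherwise both sides vanish.
    rcases eq_or_ne (P {ω | Y i ω ≤ a i}) 0 with h0 | h0
    · have : P.real ({ω | Y i ω ≤ a i} ∩ {ω | ∀ j ∈ s, Y j ω ≤ a j}) = 0 := by
        rw [measureReal_def, measure_mono_null Set.inter_subset_left h0, ENNReal.toReal_zero]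
      rw [this, measureReal_def, h0]
      simp
    set S : Set ({j : Fin n // j ≠ i} → ℝ) := {y | ∀ j, j.1 ∈ s → y j ≤ a j} with hS
    have hpre : {ω | (fun j : {j : Fin n // j ≠ i} => Y j ω) ∈ S} =
        {ω | ∀ j ∈ s, Y j ω ≤ a j} := by
      ext ω
      simp only [hS, Set.mem_ofPred_eq, Subtype.forall]
      exact ⟨fun h j hj => h j (by rintro rfl; exact hi hj) hj, fun h j _ hj => h j hj⟩
    have hlower : IsLowerSet S := fun x y hyx hx j hj => (hyx j).trans (hx j hj)
    have hmeas : MeasurableSet S := by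
      simp only [hS, Set.ofPred_forall]
      exact MeasurableSet.iInter fun j => MeasurableSet.iInter fun _ =>
        measurableSet_le (measurable_pi_apply j) measurable_const
    have h := hY i S hlower hmeas (a i) (pos_iff_ne_zero.2 h0)
    rw [hpre, cond_apply (measurableSet_le (hm i) measurable_const)] at h
    have h' := mul_le_mul_right h (P {ω | Y i ω ≤ a i})
    rw [← mul_assoc, ENNReal.mul_inv_cancel h0 (measure_ne_top _ _), one_mul] at h'
    calc P.real ({ω | Y i ω ≤ a i} ∩ {ω | ∀ j ∈ s, Y j ω ≤ a j})
        ≤ P.real {ω | Y i ω ≤ a i} * P.real {ω | ∀ j ∈ s, Y j ω ≤ a j} := by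
          simp only [measureReal_def, ← ENNReal.toReal_mul]
          exact ENNReal.toReal_mono (by finiteness) h'
      _ ≤ _ := mul_le_mul_of_nonneg_left ih measureReal_nonneg

/-- The event is relaxed to an orthant by bounding each nonnegative term `w i * (Y i - f 1)` by the
whole sum. Zero weights impose no constraint and are filtered out, which keeps `c / w i` meaningful.
-/
lemma measureReal_weighted_sum_le (hY : WeaklyNegativelyAssociated P Y)
    (hm : ∀ i, Measurable (Y i)) (hmono : MonotoneOn f (Set.Ici 1))
    (hconv : ConvexOn ℝ (Set.Ici 1) f) (hX : ∀ i, IdentDistrib (Y i) f P (paretoMeasure 1 1))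
    {w : Fin n → ℝ} (hw : ∀ i, 0 ≤ w i) {c : ℝ} (hc : 0 < c) (hsum : ∑ i, w i = c)
    {v : ℝ} (hv : 1 < v) (hfv : f 1 < f v) :
    P.real {ω | ∑ i, w i * Y i ω ≤ c * f v} ≤
      (∏ i with 0 < w i, (1 + w i / (c * (v - 1))))⁻¹ := by
  have hv1 : 0 < v - 1 := by linarith
  calc P.real {ω | ∑ i, w i * Y i ω ≤ c * f v}
      ≤ P.real {ω | ∀ i ∈ Finset.univ.filter (fun i => 0 < w i),
          Y i ω ≤ f 1 + c / w i * (f v - f 1)} := by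
        refine ENNReal.toReal_mono (measure_ne_top _ _) (measure_mono_ae ?_)
        filter_upwards [ae_all_iff.2 fun i => ae_le_of_identDistrib_pareto hmono (hX i)]
          with ω hω hle i hi
        have hwi : 0 < w i := (Finset.mem_filter.1 hi).2
        have h1 : w i * (Y i ω - f 1) ≤ ∑ j, w j * (Y j ω - f 1) :=
          Finset.single_le_sum (f := fun j => w j * (Y j ω - f 1))
            (fun j _ => mul_nonneg (hw j) (sub_nonneg.2 (hω j))) (Finset.mem_univ i)
        have h2 : ∑ j, w j * (Y j ω - f 1) = ∑ j, w j * Y j ω - c * f 1 := by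
          simp only [mul_sub, Finset.sum_sub_distrib, ← Finset.sum_mul, hsum]
        have hle' : ∑ i, w i * Y i ω ≤ c * f v := hle
        have h3 : Y i ω - f 1 ≤ c * (f v - f 1) / w i := by
          rw [le_div_iff₀ hwi]; linarith
        have h4 : c * (f v - f 1) / w i = c / w i * (f v - f 1) := by ring
        linarith
    _ ≤ ∏ i with 0 < w i, P.real {ω | Y i ω ≤ f 1 + c / w i * (f v - f 1)} :=
        hY.measureReal_forall_le_le_prod hm _ _
    _ ≤ ∏ i with 0 < w i, (1 + w i / (c * (v - 1)))⁻¹ := by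
        refine Finset.prod_le_prod (fun _ _ => measureReal_nonneg) fun i hi => ?_
        have hwi : 0 < w i := (Finset.mem_filter.1 hi).2
        have hk : 1 ≤ c / w i := by
          rw [le_div_iff₀ hwi, one_mul, ← hsum]
          exact Finset.single_le_sum (fun j _ => hw j) (Finset.mem_univ i)
        refine (measureReal_le_of_identDistrib_pareto hconv (hX i) hv hfv hk).trans_eq ?_
        have : 0 < w i + (v - 1) * c := by positivity
        have : 0 < c * (v - 1) + w i := by positivity
        field_simp
        ring
    _ = _ := Finset.prod_inv_distrib _

lemma sum_filter_pos_div {w : Fin n → ℝ} (hw : ∀ i, 0 ≤ w i) {c : ℝ} (hc : 0 < c)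
    (hsum : ∑ i, w i = c) (t : ℝ) : ∑ i with 0 < w i, w i / (c * t) = 1 / t := by
  have h : ∑ i with 0 < w i, w i = c := by
    rw [← hsum]
    refine Finset.sum_filter_of_ne fun i _ hi => lt_of_le_of_ne (hw i) hi.symm
  rw [← Finset.sum_div, h, div_mul_eq_div_div, div_self hc.ne']

lemma inv_one_add_one_div_sub_one {v : ℝ} (hv : 1 < v) : (1 + 1 / (v - 1))⁻¹ = 1 - 1 / v := by
  have hv1 : v - 1 ≠ 0 := by linarith
  have hv0 : v ≠ 0 := by linarith
  field_simp
  ring_nf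
  simp [hv0]

lemma measureReal_weighted_sum_le_one_sub (hY : WeaklyNegativelyAssociated P Y)
    (hm : ∀ i, Measurable (Y i)) (hmono : MonotoneOn f (Set.Ici 1))
    (hconv : ConvexOn ℝ (Set.Ici 1) f) (hX : ∀ i, IdentDistrib (Y i) f P (paretoMeasure 1 1))
    {w : Fin n → ℝ} (hw : ∀ i, 0 ≤ w i) {c : ℝ} (hc : 0 < c) (hsum : ∑ i, w i = c)
    {v : ℝ} (hv : 1 < v) (hfv : f 1 < f v) :
    P.real {ω | ∑ i, w i * Y i ω ≤ c * f v} ≤ 1 - 1 / v := by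
  have hv1 : 0 < v - 1 := by linarith
  refine (measureReal_weighted_sum_le hY hm hmono hconv hX hw hc hsum hv hfv).trans ?_
  rw [← inv_one_add_one_div_sub_one hv]
  refine inv_anti₀ (by positivity) ?_
  rw [← sum_filter_pos_div hw hc hsum]
  exact Finset.one_add_sum_le_prod_one_add' _ _ fun i _ => div_nonneg (hw i) (by positivity)

lemma measureReal_weighted_sum_lt_one_sub (hY : WeaklyNegativelyAssociated P Y)
    (hm : ∀ i, Measurable (Y i)) (hmono : MonotoneOn f (Set.Ici 1))
    (hconv : ConvexOn ℝ (Set.Ici 1) f) (hX : ∀ i, IdentDistrib (Y i) f P (paretoMeasure 1 1))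
    {w : Fin n → ℝ} (hw : ∀ i, 0 ≤ w i) {c : ℝ} (hc : 0 < c) (hsum : ∑ i, w i = c)
    {i j : Fin n} (hij : i ≠ j) (hi : 0 < w i) (hj : 0 < w j)
    (hatom : ∀ x : ℝ, P {ω | Y i ω = x ∧ Y j ω = x} = 0)
    {v : ℝ} (hv : 1 < v) :
    P.real {ω | ∑ i, w i * Y i ω ≤ c * f v} < 1 - 1 / v := by
  have hv1 : 0 < v - 1 := by linarith
  -- On a flat initial piece of `f` the convexity bound is unavailable, but there the event forces
  -- `Y i = Y j = f 1` a.s., which `hatom` excludes.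
  rcases (hmono Set.self_mem_Ici hv.le hv.le).eq_or_lt with hfv | hfv
  · have h0 : P {ω | ∑ i, w i * Y i ω ≤ c * f v} = 0 := by
      rw [← nonpos_iff_eq_zero, ← hatom (f 1)]
      refine measure_mono_ae ?_
      filter_upwards [ae_all_iff.2 fun i => ae_le_of_identDistrib_pareto hmono (hX i)]
        with ω hω hle
      have hle' : ∑ i, w i * Y i ω ≤ c * f v := hle
      have h2 : ∑ j, w j * (Y j ω - f 1) = ∑ j, w j * Y j ω - c * f 1 := by
        simp only [mul_sub, Finset.sum_sub_distrib, ← Finset.sum_mul, hsum]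
      rw [← hfv] at hle'
      have key : ∀ k, 0 < w k → Y k ω = f 1 := by
        intro k hk
        have h1 : w k * (Y k ω - f 1) ≤ ∑ j, w j * (Y j ω - f 1) :=
          Finset.single_le_sum (f := fun j => w j * (Y j ω - f 1))
            (fun j _ => mul_nonneg (hw j) (sub_nonneg.2 (hω j))) (Finset.mem_univ k)
        refine le_antisymm ?_ (hω k)
        by_contra hlt
        nlinarith [mul_pos hk (sub_pos.2 (not_le.1 hlt))]
      exact ⟨key i hi, key j hj⟩
    rw [measureReal_def, h0, ENNReal.toReal_zero, sub_pos, div_lt_one (by linarith)]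
    exact hv
  · refine (measureReal_weighted_sum_le hY hm hmono hconv hX hw hc hsum hv hfv).trans_lt ?_
    rw [← inv_one_add_one_div_sub_one hv]
    refine inv_strictAnti₀ (by positivity) ?_
    rw [← sum_filter_pos_div hw hc hsum]
    refine Finset.one_add_sum_lt_prod_one_add _ _
      (fun k hk => div_pos (Finset.mem_filter.1 hk).2 (by positivity)) ?_
    exact ⟨i, by simpa using hi, j, by simpa using hj, hij⟩

/-- A weighted sum of weakly negatively associated super-Pareto random variables dominates a
single one with the same total weight. -/
lemma measureReal_weighted_sum_le_measureReal_single (hY : WeaklyNegativelyAssociated P Y)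
    (hm : ∀ i, Measurable (Y i)) (hmono : MonotoneOn f (Set.Ici 1))
    (hconv : ConvexOn ℝ (Set.Ici 1) f) (hX : ∀ i, IdentDistrib (Y i) f P (paretoMeasure 1 1))
    {w : Fin n → ℝ} (hw : ∀ i, 0 ≤ w i) {c : ℝ} (hc : 0 < c) (hsum : ∑ i, w i = c)
    (i : Fin n) (x : ℝ) :
    P.real {ω | ∑ i, w i * Y i ω ≤ c * x} ≤ P.real {ω | Y i ω ≤ x} := by
  by_contra! hlt
  have hF0 : 0 ≤ P.real {ω | Y i ω ≤ x} := measureReal_nonneg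
  have hx : f 1 ≤ x := by
    by_contra! hx
    have h0 : P {ω | ∑ i, w i * Y i ω ≤ c * x} = 0 := by
      rw [measure_eq_zero_iff_ae_notMem]
      filter_upwards [ae_all_iff.2 fun i => ae_le_of_identDistrib_pareto hmono (hX i)]
        with ω hω hle
      have hle' : ∑ i, w i * Y i ω ≤ c * x := hle
      have h1 : ∑ j, w j * f 1 ≤ ∑ j, w j * Y j ω :=
        Finset.sum_le_sum fun j _ => mul_le_mul_of_nonneg_left (hω j) (hw j)
      rw [← Finset.sum_mul, hsum] at h1
      nlinarith
    have h0' : P.real {ω | ∑ i, w i * Y i ω ≤ c * x} = 0 := by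
      rw [measureReal_def, h0, ENNReal.toReal_zero]
    linarith
  -- A level `q` strictly between the two probabilities is the Pareto probability of `(-∞, v]`.
  -- Comparing `f v` with `x` contradicts one side or the other, so `f` need not be inverted.
  obtain ⟨q, hq1, hq2⟩ := exists_between hlt
  have hq3 : q < 1 := hq2.trans_le measureReal_le_one
  have hq0 : 0 < 1 - q := by linarith
  set v : ℝ := 1 / (1 - q) with hvdef
  have hv : 1 < v := by rw [hvdef, lt_div_iff₀ hq0]; linarith
  have hvq : 1 - 1 / v = q := by simp [hvdef]
  rcases le_or_gt (f v) x with hfx | hfx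
  · have h : P.real {ω | Y i ω ≤ x} = (paretoMeasure 1 1).real (f ⁻¹' Set.Iic x) :=
      congrArg ENNReal.toReal ((hX i).measure_mem_eq (measurableSet_Iic (a := x)))
    have h2 : (paretoMeasure 1 1).real (Set.Iic v) ≤
        (paretoMeasure 1 1).real (f ⁻¹' Set.Iic x) := by
      refine ENNReal.toReal_mono (measure_ne_top _ _) (measure_mono_ae ?_)
      filter_upwards [paretoMeasure_one_one_ae_ge] with s hs hsv
      exact (hmono hs hv.le hsv).trans hfx
    rw [paretoMeasure_one_one_real_Iic hv.le, ← h] at h2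
    linarith
  · have h := measureReal_weighted_sum_le_one_sub hY hm hmono hconv hX hw hc hsum hv
      (hx.trans_lt hfx)
    have h2 : P.real {ω | ∑ i, w i * Y i ω ≤ c * x} ≤
        P.real {ω | ∑ i, w i * Y i ω ≤ c * f v} :=
      measureReal_mono fun ω hω =>
        le_trans (show ∑ i, w i * Y i ω ≤ c * x from hω)
          (mul_le_mul_of_nonneg_left hfx.le hc.le)
    linarith

end Dominance

/-! ### Uniform variables and quantile transforms -/

section Quantile

variable {Ω : Type*} [MeasurableSpace Ω] {P : Measure Ω} [IsProbabilityMeasure P]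

/-- The probability integral transform: an atomless real random variable gives rise to a uniform
one on the same space. -/
lemma exists_uniform_of_atomless {W : Ω → ℝ} (hW : Measurable W)
    (hatom : ∀ x, P {ω | W ω = x} = 0) :
    ∃ U : Ω → ℝ, Measurable U ∧ (∀ᵐ ω ∂P, U ω ∈ Set.Ioo (0 : ℝ) 1) ∧
      ∀ u ∈ Set.Icc (0 : ℝ) 1, P.real {ω | U ω ≤ u} = u := by
  have : IsProbabilityMeasure (P.map W) := Measure.isProbabilityMeasure_map hW.aemeasurable
  set F := cdf (P.map W) with hF
  have hFP : ∀ x, F x = P.real {ω | W ω ≤ x} := fun x => by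
    rw [hF, cdf_eq_real, map_measureReal_apply hW measurableSet_Iic]; rfl
  have hcont : Continuous F := by
    rw [continuous_iff_continuousAt]
    intro a
    rw [F.mono.continuousAt_iff_leftLim_eq_rightLim, F.rightLim_eq]
    refine le_antisymm (F.mono.leftLim_le le_rfl) ?_
    have h := F.measure_singleton a
    rw [hF, measure_cdf, Measure.map_apply hW (measurableSet_singleton a)] at h
    have h' : P (W ⁻¹' {a}) = 0 := hatom a
    rw [h', eq_comm, ENNReal.ofReal_eq_zero] at h
    linarith
  have hsurj : ∀ u ∈ Set.Ioo (0 : ℝ) 1, ∃ y, F y = u := by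
    rintro u ⟨h0, h1⟩
    obtain ⟨a, ha⟩ := ((tendsto_cdf_atBot (P.map W)).eventually_lt_const h0).exists
    obtain ⟨b, hb⟩ := ((tendsto_cdf_atTop (P.map W)).eventually_const_lt h1).exists
    exact mem_range_of_exists_le_of_exists_ge hcont ⟨a, ha.le⟩ ⟨b, hb.le⟩
  have hU : Measurable fun ω => F (W ω) := hcont.measurable.comp hW
  have key : ∀ u ∈ Set.Ioo (0 : ℝ) 1, P.real {ω | F (W ω) ≤ u} = u := by
    intro u hu
    refine le_antisymm ?_ ?_
    · by_contra! hlt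
      -- Writing `u' = F y` with `u < u'` puts `{F (W) ≤ u}` inside `{W ≤ y}`, which has probability
      -- only `u'`.
      obtain ⟨u', h1, h2⟩ := exists_between hlt
      obtain ⟨y, rfl⟩ := hsurj u' ⟨hu.1.trans h1, h2.trans_le measureReal_le_one⟩
      refine absurd h2 (not_lt.2 ?_)
      rw [hFP y]
      refine measureReal_mono fun ω hω => ?_
      by_contra hy
      exact absurd (F.mono (not_le.1 hy).le) (not_le.2 (lt_of_le_of_lt hω h1))
    · obtain ⟨y, rfl⟩ := hsurj u hu
      conv_lhs => rw [hFP y]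
      exact measureReal_mono fun ω hω => F.mono hω
  have hzero : P.real {ω | F (W ω) ≤ 0} = 0 := by
    refine le_antisymm ?_ measureReal_nonneg
    by_contra! hlt
    obtain ⟨u, h1, h2⟩ := exists_between hlt
    have hu := key u ⟨h1, h2.trans_le measureReal_le_one⟩
    have := measureReal_mono (μ := P) (s₁ := {ω | F (W ω) ≤ 0}) (s₂ := {ω | F (W ω) ≤ u})
      fun ω hω => le_trans hω h1.le
    linarith
  have hone : P.real {ω | F (W ω) < 1} = 1 := by
    refine le_antisymm measureReal_le_one ?_
    by_contra! hlt
    obtain ⟨u, h1, h2⟩ := exists_between hlt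
    have hu := key u ⟨measureReal_nonneg.trans_lt h1, h2⟩
    have := measureReal_mono (μ := P) (s₁ := {ω | F (W ω) ≤ u}) (s₂ := {ω | F (W ω) < 1})
      fun ω hω => lt_of_le_of_lt hω h2
    linarith
  refine ⟨fun ω => F (W ω), hU, ?_, ?_⟩
  · have h0 : ∀ᵐ ω ∂P, ¬ F (W ω) ≤ 0 := by
      rw [measureReal_eq_zero_iff, measure_eq_zero_iff_ae_notMem] at hzero
      exact hzero
    have h1 : ∀ᵐ ω ∂P, F (W ω) < 1 := by
      refine (prob_compl_eq_zero_iff (measurableSet_lt hU measurable_const)).2 ?_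
      rw [← ENNReal.toReal_eq_one_iff]
      exact hone
    filter_upwards [h0, h1] with ω h0 h1 using ⟨not_le.1 h0, h1⟩
  · rintro u ⟨h0, h1⟩
    rcases h0.eq_or_lt with rfl | h0
    · exact hzero
    rcases h1.eq_or_lt with rfl | h1
    · have : {ω | F (W ω) ≤ 1} = Set.univ :=
        Set.eq_univ_of_forall fun ω => cdf_le_one _ _
      rw [this, probReal_univ]
    · exact key u ⟨h0, h1⟩

/-- The quantile function of a real distribution. -/
noncomputable def quantile (μ : Measure ℝ) (u : ℝ) : ℝ := sInf {x | u ≤ cdf μ x}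

/-- Right-continuity of the cdf makes the infimum attained. For `u` outside `(0, 1)` the set may be
empty or unbounded below. -/
lemma quantile_le_iff (μ : Measure ℝ) {u : ℝ} (hu : u ∈ Set.Ioo (0 : ℝ) 1) (x : ℝ) :
    quantile μ u ≤ x ↔ u ≤ cdf μ x := by
  obtain ⟨a, ha⟩ := ((tendsto_cdf_atBot μ).eventually_lt_const hu.1).exists
  obtain ⟨b, hb⟩ := ((tendsto_cdf_atTop μ).eventually_const_lt hu.2).exists
  have hne : {x | u ≤ cdf μ x}.Nonempty := ⟨b, hb.le⟩
  have hbdd : BddBelow {x | u ≤ cdf μ x} := by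
    refine ⟨a, fun y hy => ?_⟩
    by_contra hya
    exact absurd (hy.trans (monotone_cdf μ (not_le.1 hya).le)) (not_le.2 ha)
  refine ⟨fun h => ?_, fun h => csInf_le hbdd h⟩
  have htend := ((cdf μ).right_continuous x).tendsto.mono_left
    (nhdsWithin_mono x Set.Ioi_subset_Ici_self)
  refine ge_of_tendsto htend ?_
  filter_upwards [self_mem_nhdsWithin] with y hy
  obtain ⟨z, hz, hzy⟩ := exists_lt_of_csInf_lt hne (lt_of_le_of_lt h hy)
  exact hz.trans (monotone_cdf μ hzy.le)

/-- Both claims follow from `quantile_le_iff` applied to `U`. The last one holds for all `x` off a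
single null set, so `x` may later depend on `ω`. -/
lemma exists_identDistrib_quantile {U : Ω → ℝ} (hU : Measurable U)
    (hU01 : ∀ᵐ ω ∂P, U ω ∈ Set.Ioo (0 : ℝ) 1)
    (hunif : ∀ u ∈ Set.Icc (0 : ℝ) 1, P.real {ω | U ω ≤ u} = u) {X : Ω → ℝ}
    (hX : Measurable X) :
    ∃ Z : Ω → ℝ, Measurable Z ∧ IdentDistrib Z X P P ∧
      ∀ᵐ ω ∂P, ∀ x, P.real {ω | X ω ≤ x} < U ω → x < Z ω := by
  classical
  have : IsProbabilityMeasure (P.map X) := Measure.isProbabilityMeasure_map hX.aemeasurable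
  have hG : ∀ x, cdf (P.map X) x = P.real {ω | X ω ≤ x} := fun x => by
    rw [cdf_eq_real, map_measureReal_apply hX measurableSet_Iic]; rfl
  set Z : Ω → ℝ := fun ω => if U ω ∈ Set.Ioo (0 : ℝ) 1 then quantile (P.map X) (U ω) else 0
    with hZ
  have hIoo : MeasurableSet {ω | U ω ∈ Set.Ioo (0 : ℝ) 1} := hU measurableSet_Ioo
  have hZm : Measurable Z := by
    refine measurable_of_Iic fun x => ?_
    have : Z ⁻¹' Set.Iic x = ({ω | U ω ∈ Set.Ioo (0 : ℝ) 1} ∩ {ω | U ω ≤ cdf (P.map X) x}) ∪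
        ({ω | U ω ∈ Set.Ioo (0 : ℝ) 1}ᶜ ∩ {_ω | (0 : ℝ) ≤ x}) := by
      ext ω
      by_cases h : U ω ∈ Set.Ioo (0 : ℝ) 1
      · have h' := quantile_le_iff (P.map X) h x
        simp only [hZ, Set.mem_preimage, Set.mem_Iic, Set.mem_union, Set.mem_inter_iff,
          Set.mem_ofPred_eq, h, Set.mem_compl_iff, not_true_eq_false, false_and, or_false,
          true_and, if_true, h']
      · simp only [hZ, Set.mem_preimage, Set.mem_Iic, Set.mem_union, Set.mem_inter_iff,
          Set.mem_ofPred_eq, h, Set.mem_compl_iff, not_false_eq_true, false_and, false_or,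
          true_and, if_false]
    rw [this]
    exact (hIoo.inter (measurableSet_le hU measurable_const)).union
      (hIoo.compl.inter (MeasurableSet.const _))
  have hmap : IsProbabilityMeasure (P.map Z) := Measure.isProbabilityMeasure_map hZm.aemeasurable
  refine ⟨Z, hZm, ⟨hZm.aemeasurable, hX.aemeasurable, ?_⟩, ?_⟩
  · refine Measure.ext_of_Iic _ _ fun x => ?_
    rw [← measureReal_eq_measureReal_iff, map_measureReal_apply hZm measurableSet_Iic,
      ← cdf_eq_real]
    rw [← hunif (cdf (P.map X) x) ⟨cdf_nonneg _ _, cdf_le_one _ _⟩]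
    refine measureReal_congr ?_
    filter_upwards [hU01] with ω h
    have h' := quantile_le_iff (P.map X) h x
    refine propext ?_
    change Z ω ≤ x ↔ U ω ≤ cdf (P.map X) x
    rw [← h', hZ]
    simp only [if_pos h]
  · filter_upwards [hU01] with ω h x hx
    rw [← hG] at hx
    by_contra hlt
    have h' : quantile (P.map X) (U ω) ≤ x := by
      rw [not_lt, hZ] at hlt
      simpa only [if_pos h] using hlt
    exact absurd ((quantile_le_iff _ h x).1 h') (not_le.2 hx)

lemma identDistrib_pareto_of_uniform {U : Ω → ℝ} (hU : Measurable U)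
    (hU01 : ∀ᵐ ω ∂P, U ω ∈ Set.Ioo (0 : ℝ) 1)
    (hunif : ∀ u ∈ Set.Icc (0 : ℝ) 1, P.real {ω | U ω ≤ u} = u) :
    IdentDistrib (fun ω => 1 / (1 - U ω)) id P (paretoMeasure 1 1) := by
  have hV : Measurable fun ω => 1 / (1 - U ω) := by fun_prop
  have hmap : IsProbabilityMeasure (P.map fun ω => 1 / (1 - U ω)) :=
    Measure.isProbabilityMeasure_map hV.aemeasurable
  refine ⟨hV.aemeasurable, aemeasurable_id, ?_⟩
  rw [Measure.map_id]
  refine Measure.ext_of_Iic _ _ fun a => ?_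
  rw [← measureReal_eq_measureReal_iff, map_measureReal_apply hV measurableSet_Iic]
  -- Truncating at `1` covers `a < 1` by the same formula.
  have hmax : (paretoMeasure 1 1).real (Set.Iic a) = 1 - 1 / max 1 a := by
    rw [← paretoMeasure_one_one_real_Iic (le_max_left 1 a)]
    refine measureReal_congr ?_
    have h1 : ∀ᵐ v ∂paretoMeasure 1 1, v ≠ 1 := by
      rw [ae_iff]; simpa using! paretoMeasure_one_one_singleton 1
    filter_upwards [paretoMeasure_one_one_ae_ge, h1] with v hv hv1
    refine propext ?_
    change v ≤ a ↔ v ≤ max 1 a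
    rw [le_max_iff]
    exact ⟨Or.inr, fun h => h.resolve_left fun h => hv1 (le_antisymm h hv)⟩
  have hm1 : 1 ≤ max 1 a := le_max_left 1 a
  have hm0 : 0 < max 1 a := by linarith
  have hmem : 1 - 1 / max 1 a ∈ Set.Icc (0 : ℝ) 1 := by
    constructor
    · rw [sub_nonneg, div_le_one hm0]; exact hm1
    · rw [sub_le_self_iff]; positivity
  rw [hmax]
  refine Eq.trans ?_ (hunif _ hmem)
  refine measureReal_congr ?_
  filter_upwards [hU01] with ω hω
  refine propext ?_
  change 1 / (1 - U ω) ≤ a ↔ U ω ≤ 1 - 1 / max 1 a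
  have h0 : 0 < 1 - U ω := by linarith [hω.2]
  have h1 : 1 < 1 / (1 - U ω) := by rw [lt_div_iff₀ h0]; linarith [hω.1]
  have h2 : 1 / (1 - U ω) ≤ a ↔ 1 / (1 - U ω) ≤ max 1 a := by
    rw [le_max_iff]
    exact ⟨Or.inr, fun h => h.resolve_left (not_le.2 h1)⟩
  rw [h2, div_le_comm₀ h0 hm0]
  constructor <;> intro h <;> linarith

end Quantile

/-! ### Strictly ordered versions of the single loss and the sum -/

section Strict

variable {Ω : Type*} [MeasurableSpace Ω] {P : Measure Ω}

/-- Two random variables with at most one atom, the same for both, and whose atoms are disjoint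
give rise to an atomless random variable. -/
lemma exists_atomless {X Z : Ω → ℝ} (hX : Measurable X) (hZ : Measurable Z) {m : ℝ}
    (hXm : ∀ x ≠ m, P {ω | X ω = x} = 0) (hZm : ∀ x ≠ m, P {ω | Z ω = x} = 0)
    (hXZ : P {ω | X ω = m ∧ Z ω = m} = 0) :
    ∃ W : Ω → ℝ, Measurable W ∧ ∀ x, P {ω | W ω = x} = 0 := by
  classical
  -- Off `{X = m}` the variable `X` has no atom; on it, `Z` has none. The exponentials, of opposite
  -- signs, keep the two pieces from overlapping.
  refine ⟨fun ω => if X ω = m then -Real.exp (Z ω) else Real.exp (X ω), ?_, fun x => ?_⟩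
  · exact Measurable.ite (hX (measurableSet_singleton m)) (by fun_prop) (by fun_prop)
  have hA : P {ω | X ω = m ∧ Z ω = Real.log (-x)} = 0 := by
    rcases eq_or_ne (Real.log (-x)) m with h | h
    · rw [h]; exact hXZ
    · exact measure_mono_null (fun ω hω => hω.2) (hZm _ h)
  have hB : P {ω | X ω ≠ m ∧ X ω = Real.log x} = 0 := by
    rcases eq_or_ne (Real.log x) m with h | h
    · rw [h]
      have : {ω | X ω ≠ m ∧ X ω = m} = ∅ := by ext ω; simp
      rw [this, measure_empty]
    · exact measure_mono_null (fun ω hω => hω.2) (hXm _ h)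
  refine measure_mono_null ?_ (measure_union_null hA hB)
  intro ω hω
  have hω' : (if X ω = m then -Real.exp (Z ω) else Real.exp (X ω)) = x := hω
  split_ifs at hω' with h
  · exact Or.inl ⟨h, by rw [← hω', neg_neg, Real.log_exp]⟩
  · exact Or.inr ⟨h, by rw [← hω', Real.log_exp]⟩

variable [IsProbabilityMeasure P] {n : ℕ} {Y : Fin n → Ω → ℝ} {f : ℝ → ℝ}

/-- If at least two weights are positive and the losses have no common atoms, then there are
versions of a single loss and of the weighted sum that are strictly ordered. -/
lemma exists_identDistrib_lt (hY : WeaklyNegativelyAssociated P Y)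
    (hm : ∀ i, Measurable (Y i)) (hmono : MonotoneOn f (Set.Ici 1))
    (hconv : ConvexOn ℝ (Set.Ici 1) f) (hX : ∀ i, IdentDistrib (Y i) f P (paretoMeasure 1 1))
    {w : Fin n → ℝ} (hw : ∀ i, 0 ≤ w i) {c : ℝ} (hc : 0 < c) (hsum : ∑ i, w i = c)
    {i j : Fin n} (hij : i ≠ j) (hi : 0 < w i) (hj : 0 < w j)
    (hatom : ∀ x : ℝ, P {ω | Y i ω = x ∧ Y j ω = x} = 0) (k : Fin n) :
    ∃ X Z : Ω → ℝ, Measurable X ∧ Measurable Z ∧ IdentDistrib X (Y k) P P ∧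
      IdentDistrib Z (fun ω => ∑ i, w i * Y i ω) P P ∧ ∀ᵐ ω ∂P, c * X ω < Z ω := by
  have hlevel : ∀ l, ∀ x ≠ f 1, P {ω | Y l ω = x} = 0 := fun l x hx =>
    ((hX l).measure_mem_eq (measurableSet_singleton x)).trans
      (paretoMeasure_one_one_level hconv hmono hx)
  obtain ⟨W, hW, hWatom⟩ :=
    exists_atomless (hm i) (hm j) (hlevel i) (hlevel j) (hatom (f 1))
  obtain ⟨U, hU, hU01, hunif⟩ := exists_uniform_of_atomless hW hWatom
  have hS : Measurable fun ω => ∑ i, w i * Y i ω := by fun_prop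
  obtain ⟨Z, hZ, hZS, hlt⟩ := exists_identDistrib_quantile hU hU01 hunif hS
  -- `f` is controlled only on `[1, ∞)`; truncation makes it monotone on `ℝ`, hence measurable,
  -- without changing it Pareto-a.s.
  have hfm : Measurable fun v => f (max 1 v) := by
    refine Monotone.measurable fun a b hab => ?_
    exact hmono (Set.mem_Ici.2 (le_max_left _ _)) (Set.mem_Ici.2 (le_max_left _ _))
      (max_le_max le_rfl hab)
  have hfae : IdentDistrib (fun v => f (max 1 v)) f (paretoMeasure 1 1) (paretoMeasure 1 1) := by
    refine IdentDistrib.of_ae_eq hfm.aemeasurable ?_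
    filter_upwards [paretoMeasure_one_one_ae_ge] with v hv
    rw [max_eq_right hv]
  have hV := (identDistrib_pareto_of_uniform hU hU01 hunif).comp hfm
  refine ⟨fun ω => f (max 1 (1 / (1 - U ω))), Z, hfm.comp (by fun_prop), hZ,
    (hV.trans hfae).trans (hX k).symm, hZS, ?_⟩
  filter_upwards [hU01, hlt] with ω hω hlt
  refine hlt _ ?_
  have h0 : 0 < 1 - U ω := by linarith [hω.2]
  have h1 : 1 < 1 / (1 - U ω) := by rw [lt_div_iff₀ h0]; linarith [hω.1]
  rw [max_eq_right h1.le]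
  -- At `v = 1 / (1 - U ω)` the bound `1 - 1 / v` is exactly `U ω`.
  have h := measureReal_weighted_sum_lt_one_sub hY hm hmono hconv hX hw hc hsum hij hi hj hatom h1
  simpa using h

end Strict

/-! ### Positions, exposures and portfolio losses -/

section Portfolio

variable {Ω : Type*} {n : ℕ}

lemma totalExposure_eq_sum {w : Fin n → ℝ} (hw : w ∈ positions n) :
    totalExposure w = ∑ i, w i :=
  Finset.sum_congr rfl fun i _ => abs_of_nonneg (hw i)

lemma totalExposure_nonneg (w : Fin n → ℝ) : 0 ≤ totalExposure w :=
  Finset.sum_nonneg fun i _ => abs_nonneg (w i)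

lemma single_mem_positionsOfExposure (i : Fin n) {c : ℝ} (hc : 0 ≤ c) :
    Pi.single i c ∈ positionsOfExposure n c := by
  have h : Pi.single i c ∈ positions n := fun j => by
    rcases eq_or_ne j i with rfl | h
    · simpa using hc
    · simp [h]
  exact ⟨h, by rw [totalExposure_eq_sum h]; simp⟩

lemma portfolioLoss_single (Y : Fin n → Ω → ℝ) (g : ℝ → ℝ) (i : Fin n) {c : ℝ} (hc : 0 ≤ c) :
    portfolioLoss Y g (Pi.single i c) = fun ω => c * Y i ω - g c := by
  ext ω
  rw [portfolioLoss, (single_mem_positionsOfExposure i hc).2]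
  simp [Pi.single_apply]

lemma eq_zero_of_totalExposure_eq_zero {w : Fin n → ℝ} (h : totalExposure w = 0) : w = 0 := by
  ext i
  exact abs_eq_zero.1 ((Finset.sum_eq_zero_iff_of_nonneg fun j _ => abs_nonneg (w j)).1 h i
    (Finset.mem_univ i))

lemma exists_pair_pos_of_notMem_concentratedPositions {w : Fin n → ℝ} {c : ℝ} (hc : 0 < c)
    (hw : w ∈ positionsOfExposure n c) (hnot : w ∉ concentratedPositions n c) :
    ∃ i j, i ≠ j ∧ 0 < w i ∧ 0 < w j := by
  by_contra! hcon
  have hsum : ∑ i, w i = c := by rw [← totalExposure_eq_sum hw.1, hw.2]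
  obtain ⟨i, -, hi⟩ : ∃ i ∈ Finset.univ, 0 < w i :=
    Finset.exists_lt_of_sum_lt (by simpa [hsum] using hc)
  have hz : ∀ j, j ≠ i → w j = 0 := fun j hj => le_antisymm (hcon i j hj.symm hi) (hw.1 j)
  refine hnot ⟨i, ?_⟩
  have hwi : w i = c := by
    rw [← hsum, Finset.sum_eq_single i (fun j _ hj => hz j hj) (by simp)]
  ext j
  rcases eq_or_ne j i with rfl | hj
  · simp [hwi]
  · simp [hj, hz j hj]

variable [MeasurableSpace Ω] {P : Measure Ω} {Y : Fin n → Ω → ℝ}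

lemma measurable_portfolioLoss (hm : ∀ i, Measurable (Y i)) (g : ℝ → ℝ) (w : Fin n → ℝ) :
    Measurable (portfolioLoss Y g w) := by
  unfold portfolioLoss
  fun_prop

lemma IsWNAIDSuperPareto.exists_identDistrib_pareto (hY : IsWNAIDSuperPareto P Y) (i₀ : Fin n) :
    ∃ f : ℝ → ℝ, MonotoneOn f (Set.Ici 1) ∧ ConvexOn ℝ (Set.Ici 1) f ∧
      ∀ i, IdentDistrib (Y i) f P (paretoMeasure 1 1) := by
  obtain ⟨f, h1, h2, -, h3⟩ := hY.superPareto i₀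
  exact ⟨f, h1, h2, fun i => (hY.identDistrib i i₀).trans h3⟩

/-- Both positions have exposure `c`, so `g` contributes the same constant and only shifts the
threshold. -/
lemma IsWNAIDSuperPareto.stochLE_single [IsProbabilityMeasure P] (hY : IsWNAIDSuperPareto P Y) (g : ℝ → ℝ)
    {w : Fin n → ℝ} {c : ℝ} (hc : 0 < c) (hw : w ∈ positionsOfExposure n c) (i : Fin n) :
    StochLE P (portfolioLoss Y g (Pi.single i c)) (portfolioLoss Y g w) := by
  intro x
  obtain ⟨f, hmono, hconv, hX⟩ := hY.exists_identDistrib_pareto i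
  have hsum : ∑ i, w i = c := by rw [← totalExposure_eq_sum hw.1, hw.2]
  have h := measureReal_weighted_sum_le_measureReal_single hY.wna hY.measurable hmono hconv hX
    hw.1 hc hsum i ((x + g c) / c)
  rw [portfolioLoss_single Y g i hc.le]
  have h1 : {ω | portfolioLoss Y g w ω ≤ x} =
      {ω | ∑ i, w i * Y i ω ≤ c * ((x + g c) / c)} := by
    ext ω
    simp only [Set.mem_ofPred_eq, portfolioLoss, hw.2, mul_div_cancel₀ _ hc.ne', sub_le_iff_le_add]
  have h2 : {ω | c * Y i ω - g c ≤ x} = {ω | Y i ω ≤ (x + g c) / c} := by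
    ext ω
    simp only [Set.mem_ofPred_eq, le_div_iff₀ hc, sub_le_iff_le_add, mul_comm c]
  rw [h1]
  refine le_trans ?_ (congrArg P h2).ge
  exact (ENNReal.toReal_le_toReal (measure_ne_top _ _) (measure_ne_top _ _)).1 h

end Portfolio

theorem mainTheorem3 {Ω : Type*} [MeasurableSpace Ω] (P : Measure Ω) [IsProbabilityMeasure P]
    (n : ℕ) (hn : 2 ≤ n) (Y : Fin n → Ω → ℝ) (hY : IsWNAIDSuperPareto P Y) (g : ℝ → ℝ)
    (D : Set (Ω → ℝ)) (hD : ∀ X ∈ D, Measurable X)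
    (hDY : ∀ w ∈ positions n, ∀ Z : Ω → ℝ, Measurable Z →
      IdentDistrib Z (portfolioLoss Y g w) P P → Z ∈ D)
    (ρ : (Ω → ℝ) → EReal) (hρ : WeaklyMonotone P D ρ) :
    -- mildly monotone risk measures
    (MildlyMonotone P D ρ →
      (∀ i j, i ≠ j → ∀ x : ℝ, P {ω | Y i ω = x ∧ Y j ω = x} = 0) →
        (∀ c : ℝ, 0 < c →
          minimizers ρ Y g (positionsOfExposure n c) = concentratedPositions n c) ∧
        minimizers ρ Y g (positions n) ⊆ ⋃ c ∈ Set.Ici (0 : ℝ), concentratedPositions n c) ∧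
    -- weakly monotone risk measures
    ((∀ c : ℝ, 0 < c → (minimizers ρ Y g (positionsOfExposure n c)).Nonempty →
        (minimizers ρ Y g (positionsOfExposure n c) ∩ concentratedPositions n c).Nonempty) ∧
      ((minimizers ρ Y g (positions n)).Nonempty →
        (minimizers ρ Y g (positions n) ∩
          ⋃ c ∈ Set.Ici (0 : ℝ), concentratedPositions n c).Nonempty)) := by
  have i₀ : Fin n := ⟨0, by omega⟩
  have hmemD : ∀ w ∈ positions n, portfolioLoss Y g w ∈ D := fun w hw =>
    hDY w hw _ (measurable_portfolioLoss hY.measurable g w)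
      (IdentDistrib.refl (measurable_portfolioLoss hY.measurable g w).aemeasurable)
  have hle : ∀ c : ℝ, 0 < c → ∀ w ∈ positionsOfExposure n c, ∀ i,
      ρ (portfolioLoss Y g (Pi.single i c)) ≤ ρ (portfolioLoss Y g w) := fun c hc w hw i =>
    hρ _ (hmemD _ (single_mem_positionsOfExposure i hc.le).1) _ (hmemD w hw.1)
      (hY.stochLE_single g hc hw i)
  have hzero : ∀ w : Fin n → ℝ, totalExposure w = 0 →
      w ∈ ⋃ c ∈ Set.Ici (0 : ℝ), concentratedPositions n c := fun w hw =>
    Set.mem_biUnion (Set.self_mem_Ici (a := (0 : ℝ)))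
      ⟨i₀, by simp [eq_zero_of_totalExposure_eq_zero hw]⟩
  refine ⟨fun hmild hatom => ?_, ?_, ?_⟩
  · have hlt : ∀ c : ℝ, 0 < c → ∀ w ∈ positionsOfExposure n c, w ∉ concentratedPositions n c →
        ρ (portfolioLoss Y g (Pi.single i₀ c)) < ρ (portfolioLoss Y g w) := by
      intro c hc w hw hnot
      obtain ⟨i, j, hij, hi, hj⟩ := exists_pair_pos_of_notMem_concentratedPositions hc hw hnot
      obtain ⟨f, hmono, hconv, hX⟩ := hY.exists_identDistrib_pareto i₀
      have hsum : ∑ i, w i = c := by rw [← totalExposure_eq_sum hw.1, hw.2]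
      obtain ⟨X, Z, hXm, hZm, hXY, hZY, hXZ⟩ := exists_identDistrib_lt hY.wna hY.measurable hmono
        hconv hX hw.1 hc hsum hij hi hj (hatom i j hij) i₀
      have hsingle := single_mem_positionsOfExposure i₀ hc.le
      have hX' : IdentDistrib (fun ω => c * X ω - g c) (portfolioLoss Y g (Pi.single i₀ c)) P P := by
        rw [portfolioLoss_single Y g i₀ hc.le]
        exact hXY.comp (u := fun x => c * x - g c) (by fun_prop)
      have hZ' : IdentDistrib (fun ω => Z ω - g c) (portfolioLoss Y g w) P P := by
        have h := hZY.comp (u := fun x => x - g c) (by fun_prop)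
        unfold portfolioLoss
        rw [hw.2]
        exact h
      have hXD := hDY _ hsingle.1 _ (by fun_prop) hX'
      have hZD := hDY w hw.1 _ (by fun_prop) hZ'
      -- Weak monotonicity makes `ρ` depend only on the law, so passing to the coupled versions is
      -- harmless; mild monotonicity gives the strict step.
      calc ρ (portfolioLoss Y g (Pi.single i₀ c)) ≤ ρ (fun ω => c * X ω - g c) :=
            hρ _ (hmemD _ hsingle.1) _ hXD fun x => (hX'.measure_mem_eq measurableSet_Iic).le
        _ < ρ (fun ω => Z ω - g c) := hmild.2 _ hXD _ hZD <| by
            filter_upwards [hXZ] with ω hω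
            linarith
        _ ≤ ρ (portfolioLoss Y g w) :=
            hρ _ hZD _ (hmemD w hw.1) fun x => (hZ'.measure_mem_eq measurableSet_Iic).ge
    refine ⟨fun c hc => Set.Subset.antisymm (fun w hw => ?_) ?_, fun w hw => ?_⟩
    · by_contra hnot
      exact absurd (hw.2 _ (single_mem_positionsOfExposure i₀ hc.le))
        (not_le.2 (hlt c hc w hw.1 hnot))
    · rintro _ ⟨i, rfl⟩
      exact ⟨single_mem_positionsOfExposure i hc.le, fun v hv => hle c hc v hv i⟩
    · rcases (totalExposure_nonneg w).eq_or_lt with h0 | hc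
      · exact hzero w h0.symm
      · by_contra hnot
        refine absurd (hw.2 _ (single_mem_positionsOfExposure i₀ hc.le).1)
          (not_le.2 (hlt _ hc w ⟨hw.1, rfl⟩ fun h => hnot ?_))
        exact Set.mem_biUnion (Set.mem_Ici.2 hc.le) h
  · rintro c hc ⟨w, hw⟩
    exact ⟨Pi.single i₀ c, ⟨single_mem_positionsOfExposure i₀ hc.le,
      fun v hv => hle c hc v hv i₀⟩, i₀, rfl⟩
  · rintro ⟨w, hw⟩
    rcases (totalExposure_nonneg w).eq_or_lt with h0 | hc
    · exact ⟨w, hw, hzero w h0.symm⟩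
    -- A minimizer stays optimal when its whole exposure is moved to one loss.
    · exact ⟨Pi.single i₀ (totalExposure w), ⟨(single_mem_positionsOfExposure i₀ hc.le).1,
        fun v hv => (hle _ hc w ⟨hw.1, rfl⟩ i₀).trans (hw.2 v hv)⟩,
        Set.mem_biUnion (Set.mem_Ici.2 hc.le) ⟨i₀, rfl⟩⟩
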